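/- Let $\lambda$ be a limit ordinal of cofinality $\omega$, and let $\mathcal{E}_\lambda$ be the set of nontrivial (that is, different from the identity) elementary embeddings $j\colon \langle V_\lambda,\in\rangle\to\langle V_\lambda,\in\rangle$. For $j\in\mathcal{E}_\lambda$ and $A\in V_{\lambda+1}$ (that is, $A\subseteq V_\lambda$) put $$j\cdot A = j(A)=\bigcup_{\alpha<\lambda} j(A\cap V_\alpha).$$ For $k\in\mathcal{E}_\lambda$ write $jk=j\cdot k$, where $k$ is regarded as the set $\{\langle x,k(x)\rangle : x\in V_\lambda\}\subseteq V_\lambda$ of ordered pairs; $k$ is a square root of $j$ if $kk=j$. Let $\operatorname{rng}^+ k=\{A\in V_{\lambda+1} : \exists B\in V_{\lambda+1}\ (k(B)=A)\}$ be the extended range of $k$. Call $j\in\mathcal{E}_\lambda$ $\Sigma^1_1$-elementary if for every formula $\varphi$ of the form $\exists X_1\cdots\exists X_q\,\psi$, where $X_1,\dots,X_q$ are second-order variables ranging over the subsets of the structure and $\psi$ is a formula in the language $\{\in\}$ without second-order quantifiers (in which both first-order and second-order variables may be free), and for all parameters $A_1,\dots,A_p\subseteq V_\lambda$ and $x_1,\dots,x_r\in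 V_\lambda$, $$V_\lambda\models\varphi[A_1,\dots,A_p,x_1,\dots,x_r]\iff V_\lambda\models\varphi[j(A_1),\dots,j(A_p),j(x_1),\dots,j(x_r)].$$ Suppose that $j\in\mathcal{E}_\lambda$ is $\Sigma^1_1$-elementary. Then for any $a_0,\dots,a_m,b_0,\dots,b_n\in V_{\lambda+1}$ there is $k\in\mathcal{E}_\lambda$ that is a square root of $j$ such that $a_0,\dots,a_m\in\operatorname{rng}^+ k$ and $k(b_\ell)=j(b_\ell)$ for all $\ell\le n$. -/

import Mathlib

open scoped FirstOrder
open scoped ZFSet Cardinal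

universe u

namespace RankEmb

/-- The non-logical symbols of set theory with second-order variables from `σ`: the binary relation
`∈`, and for every second-order variable `X : σ` the unary predicate "`· ∈ X`". -/
inductive SetRel (σ : Type) : ℕ → Type
  | mem : SetRel σ 2
  | var (X : σ) : SetRel σ 1

/-- Language of set theory with second-order variables from `σ`. Its first-order formulas are the
formulas without second-order quantifiers whose second-order variables are in `σ`. -/
def setLang (σ : Type) : FirstOrder.Language.{0, 0} where
  Functions := fun _ => Empty
  Relations := SetRel σ

/-- The first-order language `{∈}` of set theory. -/
abbrev memLang : FirstOrder.Language.{0, 0} := setLang Empty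

/-- The structure `⟨M, ∈⟩` together with the assignment `X ↦ S X` of the second-order
variables. -/
@[reducible]
def setStructure {σ : Type} (M : ZFSet.{u}) (S : σ → ZFSet.{u}) : (setLang σ).Structure M where
  funMap := fun f => Empty.elim f
  RelMap := fun {_} R =>
    match R with
    | SetRel.mem => fun x => (x 0 : ZFSet.{u}) ∈ (x 1 : ZFSet.{u})
    | SetRel.var X => fun x => (x 0 : ZFSet.{u}) ∈ S X

/-- Every set `M` is a structure `⟨M, ∈⟩` for the language `{∈}`. -/
instance memStructure (M : ZFSet.{u}) : memLang.Structure M :=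
  setStructure M (fun X : Empty => X.elim)

/-- Elementary embeddings `⟨V_λ, ∈⟩ → ⟨V_λ, ∈⟩`, including the identity. -/
abbrev ElemEmb (lam : Ordinal.{u}) : Type (u + 1) := (V_ lam) ↪ₑ[memLang] (V_ lam)

/-- `𝓔_λ`: the nontrivial elementary embeddings `V_λ → V_λ`. -/
def E (lam : Ordinal.{u}) : Set (ElemEmb lam) := {j | ∃ x, j x ≠ x}

theorem inter_mem {lam α : Ordinal.{u}} (hα : α < lam) (A : ZFSet.{u}) :
    A ∩ V_ α ∈ V_ lam :=
  ZFSet.mem_vonNeumann'.2 ⟨α, hα, fun _ hx => (ZFSet.mem_inter.1 hx).2⟩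

/-- The application `j · A = ⋃_{α < λ} j (A ∩ V_α)`, for `A ⊆ V_λ`. -/
noncomputable def app {lam : Ordinal.{u}} (j : ElemEmb lam) (A : ZFSet.{u}) : ZFSet.{u} :=
  ZFSet.iUnion fun α : Set.Iio lam => (j ⟨A ∩ V_ (α : Ordinal.{u}), inter_mem α.2 A⟩ : ZFSet.{u})

/-- The embedding `j` as a set of ordered pairs `⟨x, j x⟩`. -/
noncomputable def graph {lam : Ordinal.{u}} (j : ElemEmb lam) : ZFSet.{u} :=
  ZFSet.range fun x : V_ lam => ZFSet.pair x (j x)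

/-- `k` is a square root of `j`: `k · k = j`, with `k` applied to itself as a set of pairs. -/
def IsSquareRoot {lam : Ordinal.{u}} (k j : ElemEmb lam) : Prop :=
  app k (graph k) = graph j

/-- The extended range `rng⁺ j`: the range of `A ↦ j · A` on `V_{λ+1}`. -/
def extRange {lam : Ordinal.{u}} (j : ElemEmb lam) : Set ZFSet.{u} :=
  {A | A ∈ V_ (lam + 1) ∧ ∃ B ∈ V_ (lam + 1), app j B = A}

/-- `⟨M, ∈⟩ ⊨ ∃ X₁ … X_q ψ(X₁, …, X_q, A₁, …, A_p, x₁, …, x_r)`, where `ψ` has no second-order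
quantifiers, the `X`'s range over the subsets of `M`, and the parameters are the subsets `A` and the
elements `x` of `M`. -/
def SigmaHolds (M : ZFSet.{u}) {p q r : ℕ} (ψ : (setLang (Fin p ⊕ Fin q)).Formula (Fin r))
    (A : Fin p → ZFSet.{u}) (x : Fin r → M) : Prop :=
  ∃ X : Fin q → ZFSet.{u}, (∀ i, X i ⊆ M) ∧
    @FirstOrder.Language.Formula.Realize _ M (setStructure M (Sum.elim A X)) _ ψ x

/-- `j` is `Σ¹₁`-elementary, for first-order and second-order parameters. -/
def IsSigmaOneOne {lam : Ordinal.{u}} (j : ElemEmb lam) : Prop :=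
  ∀ (p q r : ℕ) (ψ : (setLang (Fin p ⊕ Fin q)).Formula (Fin r))
    (A : Fin p → ZFSet.{u}) (x : Fin r → (V_ lam)), (∀ i, A i ∈ V_ (lam + 1)) →
    (SigmaHolds (V_ lam) ψ A x ↔ SigmaHolds (V_ lam) ψ (fun i => app j (A i)) (fun i => j (x i)))

end RankEmb

/-! Consider the statement Φ(J, a, b, c): some embedding K satisfies K·K = J, K·X_i = a_i for
suitable X_i, and K·b_l = c_l. The goal is Φ(j, a, b, j·b). If Φ is Σ¹₁, then by hypothesis it
suffices to prove Φ(j·j, j·a, j·b, j·(j·b)), which K = j and X_i = a_i witness trivially.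

The difficulty is to make Φ Σ¹₁, since elementarity of K refers to truth over V_λ, which is not
first-order definable there. Hence a second set T is quantified: its sections are closed under the
operations generating definable relations, and K preserves each section. Induction on formulas shows
that every definable relation is a section of T, so K is elementary (`exists_elemEmb`). Conversely,
for j one can take T to list the definable sets (`exists_closedFamily`). -/

namespace RankEmb

open FirstOrder FirstOrder.Language

variable {lam : Ordinal.{u}}

/-! ### Expressibility without second-order quantifiers -/

section Calculus

variable {σ : Type} {n : ℕ}

/-- A predicate on assignments of second-order and `n` first-order variables in `V_lam` is
*expressible* if one formula without second-order quantifiers defines it for all assignments. -/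
def Expressible (lam : Ordinal.{u}) (σ : Type) {n : ℕ}
    (P : (σ → ZFSet.{u}) → (Fin n → V_ lam) → Prop) : Prop :=
  ∃ φ : (setLang σ).Formula (Fin n), ∀ S v,
    @Formula.Realize _ (V_ lam) (setStructure (V_ lam) S) _ φ v ↔ P S v

namespace Expressible

variable {P Q : (σ → ZFSet.{u}) → (Fin n → V_ lam) → Prop}

theorem congr (hP : Expressible lam σ P) (h : ∀ S v, P S v ↔ Q S v) : Expressible lam σ Q := by
  obtain ⟨φ, hφ⟩ := hP
  exact ⟨φ, fun S v => (hφ S v).trans (h S v)⟩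

theorem false : Expressible lam σ (n := n) fun _ _ => False :=
  ⟨⊥, fun _ _ => Iff.rfl⟩

theorem imp (hP : Expressible lam σ P) (hQ : Expressible lam σ Q) :
    Expressible lam σ fun S v => P S v → Q S v := by
  obtain ⟨φ, hφ⟩ := hP
  obtain ⟨ψ, hψ⟩ := hQ
  exact ⟨φ.imp ψ, fun S v => imp_congr (hφ S v) (hψ S v)⟩

theorem not (hP : Expressible lam σ P) : Expressible lam σ fun S v => ¬ P S v :=
  hP.imp false

theorem and (hP : Expressible lam σ P) (hQ : Expressible lam σ Q) :
    Expressible lam σ fun S v => P S v ∧ Q S v :=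
  (hP.imp hQ.not).not.congr fun _ _ => by tauto

theorem or (hP : Expressible lam σ P) (hQ : Expressible lam σ Q) :
    Expressible lam σ fun S v => P S v ∨ Q S v :=
  (hP.not.imp hQ).congr fun _ _ => by tauto

theorem iff (hP : Expressible lam σ P) (hQ : Expressible lam σ Q) :
    Expressible lam σ fun S v => (P S v ↔ Q S v) :=
  ((hP.imp hQ).and (hQ.imp hP)).congr fun _ _ => by tauto

theorem finite_forall {ι : Type*} [Finite ι] {R : ι → (σ → ZFSet.{u}) → (Fin n → V_ lam) → Prop}
    (hR : ∀ i, Expressible lam σ (R i)) : Expressible lam σ fun S v => ∀ i, R i S v := by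
  choose φ hφ using hR
  refine ⟨Formula.iInf φ, fun S v => ?_⟩
  let _ := setStructure (V_ lam) S
  exact Formula.realize_iInf.trans (forall_congr' fun i => hφ i S v)

theorem all {R : (σ → ZFSet.{u}) → (Fin n → V_ lam) → V_ lam → Prop}
    (hR : Expressible lam σ fun S (v : Fin (n + 1) → V_ lam) => R S (Fin.init v) (v (Fin.last n))) :
    Expressible lam σ fun S v => ∀ x, R S v x := by
  obtain ⟨φ, hφ⟩ := hR
  -- The last of the `n + 1` free variables becomes the bound one; the others stay free.
  refine ⟨(BoundedFormula.relabel (n := 1)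
    (Fin.snoc (α := fun _ => Fin n ⊕ Fin 1) Sum.inl (Sum.inr 0)) φ).all, fun S v => ?_⟩
  let _ := setStructure (V_ lam) S
  refine forall_congr' fun x => BoundedFormula.realize_relabel.trans ?_
  have := hφ S (Fin.snoc v x)
  simp only [Fin.init_snoc, Fin.snoc_last] at this
  rw [← this, Formula.Realize]
  refine iff_of_eq (congrArg₂ _ (funext fun i => ?_) (Subsingleton.elim _ _))
  refine Fin.lastCases ?_ (fun i => ?_) i
  · simp [Fin.snoc]
  · simp

theorem ex {R : (σ → ZFSet.{u}) → (Fin n → V_ lam) → V_ lam → Prop}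
    (hR : Expressible lam σ fun S (v : Fin (n + 1) → V_ lam) => R S (Fin.init v) (v (Fin.last n))) :
    Expressible lam σ fun S v => ∃ x, R S v x :=
  (all (R := fun S v x => ¬ R S v x) hR.not).not.congr fun _ _ => by simp

theorem comp (hP : Expressible lam σ P) {m : ℕ} (ρ : Fin n → Fin m) :
    Expressible lam σ fun S (v : Fin m → V_ lam) => P S (v ∘ ρ) := by
  obtain ⟨φ, hφ⟩ := hP
  refine ⟨φ.relabel ρ, fun S v => ?_⟩
  let _ := setStructure (V_ lam) S
  exact Formula.realize_relabel.trans (hφ S _)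

theorem eq_var (i k : Fin n) : Expressible lam σ fun _ v => v i = v k := by
  refine ⟨Term.equal (Term.var i) (Term.var k), fun S v => ?_⟩
  let _ := setStructure (V_ lam) S
  exact Formula.realize_equal

theorem mem_var (i k : Fin n) : Expressible lam σ fun _ v => (v i : ZFSet) ∈ (v k : ZFSet) := by
  refine ⟨Relations.formula₂ (L := setLang σ) (SetRel.mem : SetRel σ 2)
    (Term.var i) (Term.var k), fun S v => ?_⟩
  let _ := setStructure (V_ lam) S
  exact Formula.realize_rel₂

theorem pred_var (X : σ) (i : Fin n) : Expressible lam σ fun S v => (v i : ZFSet) ∈ S X := by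
  refine ⟨Relations.formula₁ (L := setLang σ) (SetRel.var X : SetRel σ 1)
    (Term.var i), fun S v => ?_⟩
  let _ := setStructure (V_ lam) S
  exact Formula.realize_rel₁

end Expressible

theorem pair_mem (hlim : Order.IsSuccLimit lam) {x y : ZFSet.{u}} (hx : x ∈ V_ lam)
    (hy : y ∈ V_ lam) : ZFSet.pair x y ∈ V_ lam := by
  rw [ZFSet.mem_vonNeumann] at *
  -- A Kuratowski pair has rank two above the larger rank of its components.
  have h := hlim.succ_lt (hlim.succ_lt (max_lt hx hy))
  refine lt_of_le_of_lt ?_ h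
  rw [ZFSet.pair]
  simp only [ZFSet.rank_pair, ZFSet.rank_singleton]
  simp

/-- The ordered pair as an operation on `V_lam`. -/
def vpair (hlim : Order.IsSuccLimit lam) (x y : V_ lam) : V_ lam :=
  ⟨ZFSet.pair x y, pair_mem hlim x.2 y.2⟩

theorem vpair_inj (hlim : Order.IsSuccLimit lam) {x y x' y' : V_ lam} :
    vpair hlim x y = vpair hlim x' y' ↔ x = x' ∧ y = y' := by
  rw [Subtype.ext_iff, vpair, vpair, ZFSet.pair_inj, Subtype.ext_iff, Subtype.ext_iff]

theorem mem_of_mem (x : V_ lam) {y : ZFSet.{u}} (h : y ∈ (x : ZFSet)) : y ∈ V_ lam :=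
  ZFSet.isTransitive_vonNeumann lam |>.mem_trans h x.2

theorem ext_mem {x y : ZFSet.{u}} (hx : x ⊆ V_ lam) (hy : y ⊆ V_ lam)
    (h : ∀ w : V_ lam, (w : ZFSet) ∈ x ↔ (w : ZFSet) ∈ y) : x = y :=
  ZFSet.ext fun w => ⟨fun hw => (h ⟨w, hx hw⟩).1 hw, fun hw => (h ⟨w, hy hw⟩).2 hw⟩

theorem subset_of (x : V_ lam) : (x : ZFSet) ⊆ V_ lam := fun _ => mem_of_mem x

theorem eq_doubleton_iff {x y : V_ lam} (z : V_ lam) :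
    (∀ w : V_ lam, (w : ZFSet) ∈ (z : ZFSet) ↔ w = x ∨ w = y) ↔ (z : ZFSet) = {↑x, ↑y} := by
  constructor
  · intro h
    refine ext_mem (subset_of z) ?_ fun w => ?_
    · intro w hw
      rcases ZFSet.mem_pair.1 hw with rfl | rfl <;> exact Subtype.prop _
    · rw [h, ZFSet.mem_pair, Subtype.ext_iff, Subtype.ext_iff]
  · intro h w
    rw [h, ZFSet.mem_pair, Subtype.ext_iff, Subtype.ext_iff]

theorem eq_vpair_iff (hlim : Order.IsSuccLimit lam) (x y z : V_ lam) :
    (∃ a b : V_ lam, (∀ w : V_ lam, (w : ZFSet) ∈ (a : ZFSet) ↔ w = x ∨ w = x) ∧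
      (∀ w : V_ lam, (w : ZFSet) ∈ (b : ZFSet) ↔ w = x ∨ w = y) ∧
      (∀ w : V_ lam, (w : ZFSet) ∈ (z : ZFSet) ↔ w = a ∨ w = b)) ↔ z = vpair hlim x y := by
  simp only [eq_doubleton_iff, ZFSet.pair_eq_singleton]
  constructor
  · rintro ⟨a, b, ha, hb, hz⟩
    exact Subtype.ext (by rw [hz, ha, hb]; rfl)
  · rintro rfl
    have h {w} (hw : w ∈ ZFSet.pair (x : ZFSet) y) := mem_of_mem (vpair hlim x y) hw
    exact ⟨⟨{↑x}, h (by simp [ZFSet.pair])⟩, ⟨{↑x, ↑y}, h (by simp [ZFSet.pair])⟩, rfl, rfl, rfl⟩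

/-- Terms built from variables by forming ordered pairs. -/
inductive IsTerm (hlim : Order.IsSuccLimit lam) {n : ℕ} : ((Fin n → V_ lam) → V_ lam) → Prop
  | var (i : Fin n) : IsTerm hlim fun v => v i
  | pair {f g : (Fin n → V_ lam) → V_ lam} (hf : IsTerm hlim f) (hg : IsTerm hlim g) :
      IsTerm hlim fun v => vpair hlim (f v) (g v)

namespace Expressible

variable {hlim : Order.IsSuccLimit lam} {f g : (Fin n → V_ lam) → V_ lam}

theorem eq_vpair_var (hlim : Order.IsSuccLimit lam) (i k l : Fin n) :
    Expressible lam σ fun _ v => v i = vpair hlim (v k) (v l) := by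
  refine congr ?_ fun S v => eq_vpair_iff hlim (v k) (v l) (v i)
  refine ex (ex (and (all ?_) (and (all ?_) (all ?_)))) <;>
    exact iff (mem_var _ _) (or (eq_var _ _) (eq_var _ _))

theorem var_eq_term (hf : IsTerm hlim f) {m : ℕ} (ρ : Fin n → Fin m) (i : Fin m) :
    Expressible lam σ fun _ v => v i = f (v ∘ ρ) := by
  induction hf generalizing m with
  | var k => exact eq_var _ _
  | @pair f g hf hg ihf ihg =>
    refine congr (P := fun S v => ∃ x y, x = f (v ∘ ρ) ∧ y = g (v ∘ ρ) ∧ v i = vpair hlim x y)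
      (ex (ex (and ?_ (and ?_ ?_)))) fun S v => by simp
    · exact ihf (Fin.castSucc ∘ Fin.castSucc ∘ ρ) (Fin.castSucc (Fin.last m))
    · exact ihg (Fin.castSucc ∘ Fin.castSucc ∘ ρ) (Fin.last (m + 1))
    · exact eq_vpair_var hlim (Fin.castSucc (Fin.castSucc i)) (Fin.castSucc (Fin.last m))
        (Fin.last (m + 1))

/-- The language has no function symbols, so a pairing term enters a formula through an existential
quantifier over its value. -/
theorem subst {R : (σ → ZFSet.{u}) → (Fin n → V_ lam) → V_ lam → Prop} (hf : IsTerm hlim f)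
    (hR : Expressible lam σ fun S (v : Fin (n + 1) → V_ lam) => R S (Fin.init v) (v (Fin.last n))) :
    Expressible lam σ fun S v => R S v (f v) :=
  congr (P := fun S v => ∃ x, x = f v ∧ R S v x)
    (ex (and (var_eq_term hf Fin.castSucc (Fin.last n)) hR)) fun S v => by simp

theorem eq (hf : IsTerm hlim f) (hg : IsTerm hlim g) : Expressible lam σ fun _ v => f v = g v :=
  subst (R := fun _ v x => x = g v) hf (var_eq_term hg Fin.castSucc (Fin.last n))

theorem mem (hf : IsTerm hlim f) (hg : IsTerm hlim g) :
    Expressible lam σ fun _ v => (f v : ZFSet) ∈ (g v : ZFSet) :=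
  congr (P := fun _ v => ∃ x y, x = f v ∧ y = g v ∧ (x : ZFSet) ∈ (y : ZFSet))
    (ex (ex (and (var_eq_term hf (Fin.castSucc ∘ Fin.castSucc) (Fin.castSucc (Fin.last n)))
      (and (var_eq_term hg (Fin.castSucc ∘ Fin.castSucc) (Fin.last (n + 1))) (mem_var _ _)))))
    fun S v => by simp

theorem pred (X : σ) (hf : IsTerm hlim f) : Expressible lam σ fun S v => (f v : ZFSet) ∈ S X :=
  subst (R := fun S _ x => (x : ZFSet) ∈ S X) hf (pred_var _ _)

theorem unary {P : (σ → ZFSet.{u}) → (Fin 1 → V_ lam) → Prop} (hP : Expressible lam σ P)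
    (hf : IsTerm hlim f) : Expressible lam σ fun S v => P S fun _ => f v :=
  subst (R := fun S _ x => P S fun _ => x) hf (hP.comp fun _ => Fin.last n)

end Expressible

end Calculus

/-! ### The first-order conditions on K and T -/

/-- `K` is the graph of a map `V_lam → V_lam` which commutes with pairing and has a fixed point. -/
def IsPairingMap (hlim : Order.IsSuccLimit lam) (K : ZFSet.{u}) : Prop :=
  (∀ z : V_ lam, (z : ZFSet) ∈ K → ∃ x y, z = vpair hlim x y) ∧
  (∀ x, ∃ y, (vpair hlim x y : ZFSet) ∈ K) ∧
  (∀ x y y', (vpair hlim x y : ZFSet) ∈ K → (vpair hlim x y' : ZFSet) ∈ K → y = y') ∧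
  (∃ e, (vpair hlim e e : ZFSet) ∈ K) ∧
  ∀ x y x' y', (vpair hlim x x' : ZFSet) ∈ K → (vpair hlim y y' : ZFSet) ∈ K →
    (vpair hlim (vpair hlim x y) (vpair hlim x' y') : ZFSet) ∈ K

/-- The family of sections `{t | ⟨c, t⟩ ∈ T}` is closed under the operations by which the relations
definable over `⟨V_lam, ∈⟩` are generated, with tuples coded by iterated pairs. -/
def IsClosedFamily (hlim : Order.IsSuccLimit lam) (T : ZFSet.{u}) : Prop :=
  (∃ c, ∀ t, ¬ (vpair hlim c t : ZFSet) ∈ T) ∧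
  (∀ c d, ∃ e, ∀ t, (vpair hlim e t : ZFSet) ∈ T ↔
    ((vpair hlim c t : ZFSet) ∈ T → (vpair hlim d t : ZFSet) ∈ T)) ∧
  (∀ c, ∃ e, ∀ t, (vpair hlim e t : ZFSet) ∈ T ↔
    ∀ x, (vpair hlim c (vpair hlim t x) : ZFSet) ∈ T) ∧
  (∃ c, ∀ t y x, (vpair hlim c (vpair hlim (vpair hlim t y) x) : ZFSet) ∈ T ↔ y = x) ∧
  (∀ c, ∃ e, ∀ t y x, (vpair hlim e (vpair hlim (vpair hlim t y) x) : ZFSet) ∈ T ↔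
    (vpair hlim c (vpair hlim t x) : ZFSet) ∈ T) ∧
  (∀ c d, ∃ e, ∀ t, (vpair hlim e t : ZFSet) ∈ T ↔
    ∃ x y, (vpair hlim c (vpair hlim t x) : ZFSet) ∈ T ∧
      (vpair hlim d (vpair hlim t y) : ZFSet) ∈ T ∧ x = y) ∧
  (∀ c d, ∃ e, ∀ t, (vpair hlim e t : ZFSet) ∈ T ↔
    ∃ x y, (vpair hlim c (vpair hlim t x) : ZFSet) ∈ T ∧
      (vpair hlim d (vpair hlim t y) : ZFSet) ∈ T ∧ (x : ZFSet) ∈ (y : ZFSet))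

/-- The map with graph `K` preserves every section of `T`. -/
def PreservesFamily (hlim : Order.IsSuccLimit lam) (K T : ZFSet.{u}) : Prop :=
  ∀ c t t', (vpair hlim t t' : ZFSet) ∈ K →
    ((vpair hlim c t' : ZFSet) ∈ T ↔ (vpair hlim c t : ZFSet) ∈ T)

/-- `B ∩ V_lam` is the union of the values on the `w ∈ V_lam` with `w ⊆ A` of the map with
graph `K`. -/
def AppEq (hlim : Order.IsSuccLimit lam) (K A B : ZFSet.{u}) : Prop :=
  ∀ z : V_ lam, (z : ZFSet) ∈ B ↔ ∃ w y : V_ lam,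
    (∀ u : V_ lam, (u : ZFSet) ∈ (w : ZFSet) → (u : ZFSet) ∈ A) ∧
      (vpair hlim w y : ZFSet) ∈ K ∧ (z : ZFSet) ∈ (y : ZFSet)

section Expressible

variable {σ : Type} (hlim : Order.IsSuccLimit lam) (K T A B : σ)

theorem expressible_isPairingMap :
    Expressible lam σ (n := 0) fun S _ => IsPairingMap hlim (S K) := by
  unfold IsPairingMap
  repeat' first
    | apply IsTerm.pair | apply IsTerm.var | apply Expressible.all | apply Expressible.ex
    | apply Expressible.and | apply Expressible.iff
    | apply Expressible.imp | apply Expressible.eq (hlim := hlim)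
    | apply Expressible.pred (hlim := hlim)

theorem expressible_isClosedFamily :
    Expressible lam σ (n := 0) fun S _ => IsClosedFamily hlim (S T) := by
  unfold IsClosedFamily
  repeat' first
    | apply IsTerm.pair | apply IsTerm.var | apply Expressible.all | apply Expressible.ex
    | apply Expressible.and | apply Expressible.iff
    | apply Expressible.not | apply Expressible.imp | apply Expressible.eq (hlim := hlim)
    | apply Expressible.pred (hlim := hlim)
    | apply Expressible.mem (hlim := hlim)

theorem expressible_preservesFamily :
    Expressible lam σ (n := 0) fun S _ => PreservesFamily hlim (S K) (S T) := by
  unfold PreservesFamily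
  repeat' first
    | apply IsTerm.pair | apply IsTerm.var | apply Expressible.all
    | apply Expressible.iff | apply Expressible.imp
    | apply Expressible.pred (hlim := hlim)

theorem expressible_appEq :
    Expressible lam σ (n := 0) fun S _ => AppEq hlim (S K) (S A) (S B) := by
  unfold AppEq
  repeat' first
    | apply IsTerm.pair | apply IsTerm.var | apply Expressible.all | apply Expressible.ex
    | apply Expressible.and | apply Expressible.iff
    | apply Expressible.imp | apply Expressible.pred (hlim := hlim)
    | apply Expressible.mem (hlim := hlim)

end Expressible

/-! ### Closed families contain all definable relations -/

section Tuple

variable (hlim : Order.IsSuccLimit lam)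

/-- The code `⟨… ⟨⟨e, v 0⟩, v 1⟩, …⟩` of the tuple `v`. -/
def tuple (e : V_ lam) : ∀ {n : ℕ}, (Fin n → V_ lam) → V_ lam
  | 0, _ => e
  | n + 1, v => vpair hlim (tuple e (Fin.init v)) (v (Fin.last n))

theorem tuple_snoc (e : V_ lam) {n : ℕ} (v : Fin n → V_ lam) (x : V_ lam) :
    tuple hlim e (Fin.snoc v x : Fin (n + 1) → V_ lam) = vpair hlim (tuple hlim e v) x := by
  rw [tuple, Fin.init_snoc, Fin.snoc_last]

/-- This is where the fixed point is needed: it serves as the base of every tuple code. -/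
theorem map_tuple {k : V_ lam → V_ lam} (hk : ∀ x y, k (vpair hlim x y) = vpair hlim (k x) (k y))
    {e : V_ lam} (he : k e = e) {n : ℕ} (v : Fin n → V_ lam) :
    k (tuple hlim e v) = tuple hlim e (k ∘ v) := by
  induction n with
  | zero => exact he
  | succ n ih => rw [tuple, hk, ih]; rfl

variable {hlim} {T : ZFSet.{u}}

/-- The last coordinate is read off by the equality section; earlier ones are reached by inserting
dummy coordinates. Atomic formulas are then composed from these projections. -/
theorem IsClosedFamily.exists_proj (hT : IsClosedFamily hlim T) (e : V_ lam) {n : ℕ} (i : Fin n) :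
    ∃ c, ∀ (v : Fin n → V_ lam) x,
      (vpair hlim c (vpair hlim (tuple hlim e v) x) : ZFSet) ∈ T ↔ v i = x := by
  induction n with
  | zero => exact i.elim0
  | succ n ih =>
    refine Fin.lastCases ?_ (fun i => ?_) i
    · obtain ⟨c, hc⟩ := hT.2.2.2.1
      exact ⟨c, fun v x => hc _ _ _⟩
    · obtain ⟨c, hc⟩ := ih i
      obtain ⟨d, hd⟩ := hT.2.2.2.2.1 c
      exact ⟨d, fun v x => (hd _ _ _).trans (hc _ _)⟩

/-- Every relation definable over `⟨V_lam, ∈⟩` is a section of a closed family. -/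
theorem IsClosedFamily.exists_section (hT : IsClosedFamily hlim T) (e : V_ lam) {n : ℕ}
    (φ : memLang.BoundedFormula Empty n) :
    ∃ c, ∀ v : Fin n → V_ lam,
      (vpair hlim c (tuple hlim e v) : ZFSet) ∈ T ↔ φ.Realize Empty.elim v := by
  have hvar {n : ℕ} (t : memLang.Term (Empty ⊕ Fin n)) :
      ∃ i, ∀ v : Fin n → V_ lam, t.realize (Sum.elim Empty.elim v) = v i := by
    rcases t with (i | i) | ⟨f, _⟩
    · exact i.elim
    · exact ⟨i, fun _ => rfl⟩
    · exact Empty.elim f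
  induction φ with
  | falsum =>
    obtain ⟨c, hc⟩ := hT.1
    exact ⟨c, fun v => iff_of_false (hc _) id⟩
  | equal s t =>
    obtain ⟨i, hi⟩ := hvar s
    obtain ⟨k, hk⟩ := hvar t
    obtain ⟨c, hc⟩ := hT.exists_proj e i
    obtain ⟨d, hd⟩ := hT.exists_proj e k
    obtain ⟨r, hr⟩ := hT.2.2.2.2.2.1 c d
    refine ⟨r, fun v => (hr _).trans ?_⟩
    rw [BoundedFormula.Realize, hi, hk]
    simp only [hc, hd]
    aesop
  | @rel _ l R ts =>
    cases R with
    | var X => exact X.elim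
    | mem =>
      obtain ⟨i, hi⟩ := hvar (ts 0)
      obtain ⟨k, hk⟩ := hvar (ts 1)
      obtain ⟨c, hc⟩ := hT.exists_proj e i
      obtain ⟨d, hd⟩ := hT.exists_proj e k
      obtain ⟨r, hr⟩ := hT.2.2.2.2.2.2 c d
      refine ⟨r, fun v => (hr _).trans ?_⟩
      change _ ↔ (((ts 0).realize (Sum.elim Empty.elim v) : V_ lam) : ZFSet) ∈
        (((ts 1).realize (Sum.elim Empty.elim v) : V_ lam) : ZFSet)
      rw [hi, hk]
      simp only [hc, hd]
      aesop
  | imp φ ψ ihφ ihψ =>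
    obtain ⟨c, hc⟩ := ihφ
    obtain ⟨d, hd⟩ := ihψ
    obtain ⟨r, hr⟩ := hT.2.1 c d
    exact ⟨r, fun v => (hr _).trans (imp_congr (hc v) (hd v))⟩
  | all φ ih =>
    obtain ⟨c, hc⟩ := ih
    obtain ⟨r, hr⟩ := hT.2.2.1 c
    refine ⟨r, fun v => (hr _).trans (forall_congr' fun x => ?_)⟩
    rw [← tuple_snoc, hc]

end Tuple

/-- A map commuting with pairing and preserving a closed family is elementary. -/
theorem exists_elemEmb {hlim : Order.IsSuccLimit lam} {K T : ZFSet.{u}} (hKV : K ⊆ V_ lam)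
    (hK : IsPairingMap hlim K) (hT : IsClosedFamily hlim T) (hKT : PreservesFamily hlim K T) :
    ∃ k : ElemEmb lam, graph k = K := by
  obtain ⟨hK₁, hK₂, hK₃, ⟨e, he⟩, hK₅⟩ := hK
  choose k hk using hK₂
  have hpair x y : k (vpair hlim x y) = vpair hlim (k x) (k y) :=
    hK₃ _ _ _ (hk _) (hK₅ _ _ _ _ (hk x) (hk y))
  refine ⟨⟨k, fun n φ v => ?_⟩, ZFSet.ext fun z => ?_⟩
  · obtain ⟨c, hc⟩ := hT.exists_section e (BoundedFormula.relabel Sum.inr φ)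
    rw [← Formula.realize_relabel_sumInr φ (v := Empty.elim),
      ← Formula.realize_relabel_sumInr φ (v := Empty.elim)]
    refine (hc _).symm.trans (Iff.trans ?_ (hc _))
    -- Preservation of one section at the code of `v` is preservation of `φ` at `v`, because `k`
    -- maps codes to codes coordinatewise.
    have := hKT c _ _ (hk (tuple hlim e v))
    rwa [map_tuple hlim hpair (hK₃ _ _ _ (hk e) he)] at this
  · rw [graph, ZFSet.mem_range]
    constructor
    · rintro ⟨x, rfl⟩
      exact hk x
    · intro hz
      obtain ⟨x, y, hxy⟩ := hK₁ ⟨z, hKV hz⟩ hz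
      have hxy' : z = vpair hlim x y := congrArg Subtype.val hxy
      subst hxy'
      exact ⟨x, by rw [← hK₃ _ _ _ (hk x) hz]; rfl⟩

theorem Expressible.map_iff {n : ℕ} {P : (Empty → ZFSet.{u}) → (Fin n → V_ lam) → Prop}
    (hP : Expressible lam Empty P) (j : ElemEmb lam) (v : Fin n → V_ lam) :
    P (fun X => X.elim) (j ∘ v) ↔ P (fun X => X.elim) v := by
  obtain ⟨φ, hφ⟩ := hP
  rw [← hφ, ← hφ]
  exact j.map_formula' φ v

/-! ### Elementary embeddings and their graphs -/

section ElemEmb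

variable (j : ElemEmb lam)

theorem map_vpair (hlim : Order.IsSuccLimit lam) (x y : V_ lam) :
    j (vpair hlim x y) = vpair hlim (j x) (j y) :=
  ((Expressible.eq_vpair_var hlim (0 : Fin 3) 1 2).map_iff j ![vpair hlim x y, x, y]).2 rfl

theorem map_subset {x y : V_ lam} (h : (x : ZFSet) ⊆ y) : (j x : ZFSet) ⊆ j y := by
  have hE : Expressible lam Empty fun _ (v : Fin 2 → V_ lam) =>
      ∀ u : V_ lam, (u : ZFSet) ∈ (v 0 : ZFSet) → (u : ZFSet) ∈ (v 1 : ZFSet) :=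
    .all (.imp (.mem_var _ _) (.mem_var _ _))
  intro z hz
  exact (hE.map_iff j ![x, y]).2 (fun u hu => h hu) ⟨z, mem_of_mem _ hz⟩ hz

theorem exists_fixed (hlim : Order.IsSuccLimit lam) : ∃ e : V_ lam, j e = e := by
  have hE : Expressible lam Empty fun _ (v : Fin 1 → V_ lam) =>
      ∀ u : V_ lam, ¬ (u : ZFSet) ∈ (v 0 : ZFSet) := .all (.not (.mem_var _ _))
  have h0 : (∅ : ZFSet.{u}) ∈ V_ lam := by
    rw [ZFSet.mem_vonNeumann, ZFSet.rank_empty]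
    exact hlim.bot_lt
  refine ⟨⟨∅, h0⟩, Subtype.ext ((ZFSet.eq_empty _).2 fun y hy => ?_)⟩
  exact (hE.map_iff j ![⟨∅, h0⟩]).2 (fun u => ZFSet.notMem_empty _) ⟨y, mem_of_mem _ hy⟩ hy

/-- Each `w ⊆ A` in V_λ lies inside some A ∩ V_α, and `j` is monotone for inclusion. The levels V_α
therefore need not be mentioned in formulas. -/
theorem mem_app {A z : ZFSet.{u}} :
    z ∈ app j A ↔ ∃ w : V_ lam, (w : ZFSet) ⊆ A ∧ z ∈ (j w : ZFSet) := by
  rw [app, ZFSet.mem_iUnion]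
  constructor
  · rintro ⟨α, hα⟩
    exact ⟨_, fun u hu => (ZFSet.mem_inter.1 hu).1, hα⟩
  · rintro ⟨w, hw, hz⟩
    obtain ⟨α, hα, hwα⟩ := ZFSet.mem_vonNeumann'.1 w.2
    exact ⟨⟨α, hα⟩, map_subset j (fun u hu => ZFSet.mem_inter.2 ⟨hw hu, hwα hu⟩) hz⟩

theorem app_subset (A : ZFSet.{u}) : app j A ⊆ V_ lam := by
  intro z hz
  obtain ⟨w, -, hw⟩ := (mem_app j).1 hz
  exact mem_of_mem _ hw

theorem graph_subset (hlim : Order.IsSuccLimit lam) : graph j ⊆ V_ lam := by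
  intro z hz
  obtain ⟨x, rfl⟩ := ZFSet.mem_range.1 hz
  exact (vpair hlim x (j x)).2

variable (hlim : Order.IsSuccLimit lam)

theorem vpair_mem_graph {x y : V_ lam} : (vpair hlim x y : ZFSet) ∈ graph j ↔ j x = y := by
  rw [graph, ZFSet.mem_range]
  constructor
  · rintro ⟨x', h⟩
    have h' : vpair hlim x' (j x') = vpair hlim x y := Subtype.ext h
    obtain ⟨rfl, rfl⟩ := (vpair_inj hlim).1 h'
    rfl
  · rintro rfl
    exact ⟨x, rfl⟩

theorem appEq_graph_iff {A B : ZFSet.{u}} (hB : B ⊆ V_ lam) :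
    AppEq hlim (graph j) A B ↔ app j A = B := by
  have key (z : V_ lam) : (∃ w y : V_ lam,
      (∀ u : V_ lam, (u : ZFSet) ∈ (w : ZFSet) → (u : ZFSet) ∈ A) ∧
        (vpair hlim w y : ZFSet) ∈ graph j ∧ (z : ZFSet) ∈ (y : ZFSet)) ↔
      (z : ZFSet) ∈ app j A := by
    simp only [vpair_mem_graph, mem_app]
    constructor
    · rintro ⟨w, _, hw, rfl, hz⟩
      exact ⟨w, fun u hu => hw ⟨u, mem_of_mem _ hu⟩ hu, hz⟩
    · rintro ⟨w, hw, hz⟩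
      exact ⟨w, _, fun u hu => hw hu, rfl, hz⟩
  simp only [AppEq, key]
  constructor
  · exact fun h => (ext_mem hB (app_subset j A) h).symm
  · rintro rfl z
    rfl

theorem isPairingMap_graph : IsPairingMap hlim (graph j) := by
  simp only [IsPairingMap, vpair_mem_graph]
  refine ⟨fun z hz => ?_, fun x => ⟨_, rfl⟩, ?_, exists_fixed j hlim, ?_⟩
  · obtain ⟨x, hx⟩ := ZFSet.mem_range.1 hz
    exact ⟨x, j x, Subtype.ext hx.symm⟩
  · rintro x y y' rfl rfl
    rfl
  · rintro x y _ _ rfl rfl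
    exact map_vpair j hlim x y

end ElemEmb

/-! ### The family of definable sets -/

theorem infinite_vonNeumann (hlim : Order.IsSuccLimit lam) : Infinite (V_ lam) := by
  have h (n : ℕ) : (n : Ordinal.{u}) < lam := by
    induction n with
    | zero => simpa using hlim.bot_lt
    | succ n ih => simpa using hlim.succ_lt ih
  refine Infinite.of_injective (fun n : ℕ => (⟨V_ n, ZFSet.vonNeumann_mem_of_lt (h n)⟩ : V_ lam))
    fun m n hmn => ?_
  simpa using congrArg Subtype.val hmn

instance : Countable (memLang.Symbols) := by
  have h : Countable (Σ l, memLang.Relations l) := by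
    refine Function.Injective.countable (f := fun _ => ()) ?_
    rintro ⟨_, _ | X⟩ ⟨_, _ | Y⟩ _
    · rfl
    · exact Y.elim
    · exact X.elim
    · exact X.elim
  have h' : IsEmpty (Σ l, memLang.Functions l) := ⟨fun f => Empty.elim f.2⟩
  exact inferInstanceAs (Countable (_ ⊕ _))

/-- The subsets of `V_lam` definable over `⟨V_lam, ∈⟩` form a closed family, and they are preserved
by elementary embeddings. -/
theorem exists_closedFamily (hlim : Order.IsSuccLimit lam) (j : ElemEmb lam) :
    ∃ T : ZFSet.{u}, T ⊆ V_ lam ∧ IsClosedFamily hlim T ∧ PreservesFamily hlim (graph j) T := by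
  have := infinite_vonNeumann hlim
  -- There are only countably many formulas, so they can be coded by elements of V_λ. The coding
  -- need not be definable, since `j` is never applied to a code.
  obtain ⟨g, hg⟩ : ∃ g : memLang.Formula (Fin 1) → V_ lam, g.Injective := by
    obtain ⟨g, hg⟩ := exists_injective_nat (memLang.Formula (Fin 1))
    exact ⟨_, (Infinite.natEmbedding (V_ lam)).injective.comp hg⟩
  let T : ZFSet.{u} := (V_ lam).sep fun z => ∃ (φ : memLang.Formula (Fin 1)) (t : V_ lam),
    z = vpair hlim (g φ) t ∧ φ.Realize fun _ => t
  have hT (φ : memLang.Formula (Fin 1)) (t : V_ lam) :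
      (vpair hlim (g φ) t : ZFSet) ∈ T ↔ φ.Realize fun _ => t := by
    rw [ZFSet.mem_sep]
    constructor
    · rintro ⟨-, ψ, s, h, hs⟩
      obtain ⟨h₁, rfl⟩ := (vpair_inj hlim).1 (Subtype.ext h)
      rwa [hg h₁]
    · exact fun h => ⟨Subtype.prop _, φ, t, rfl, h⟩
  have hsec (c : V_ lam) :
      Expressible lam Empty fun _ (v : Fin 1 → V_ lam) => (vpair hlim c (v 0) : ZFSet) ∈ T := by
    -- A section at a non-code is empty, hence also definable.
    by_cases hc : ∃ φ, g φ = c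
    · obtain ⟨φ, rfl⟩ := hc
      refine ⟨φ, fun S v => ?_⟩
      refine Iff.trans ?_ (hT φ (v 0)).symm
      rw [Subsingleton.elim S fun X => X.elim]
      exact iff_of_eq (congrArg _ (funext fun i => congrArg v (Subsingleton.elim _ _)))
    · refine Expressible.false.congr fun S v => iff_of_false id fun h => hc ?_
      obtain ⟨-, ψ, s, h, -⟩ := ZFSet.mem_sep.1 h
      exact ⟨ψ, ((vpair_inj hlim).1 (Subtype.ext h)).1.symm⟩
  have hterm (c : V_ lam) {n : ℕ} {f : (Fin n → V_ lam) → V_ lam} (hf : IsTerm hlim f) :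
      Expressible lam Empty fun _ v => (vpair hlim c (f v) : ZFSet) ∈ T :=
    (hsec c).unary hf
  have hex (P : V_ lam → Prop) (hP : Expressible lam Empty fun _ (v : Fin 1 → V_ lam) => P (v 0)) :
      ∃ c, ∀ t, (vpair hlim c t : ZFSet) ∈ T ↔ P t := by
    obtain ⟨φ, hφ⟩ := hP
    exact ⟨g φ, fun t => (hT φ t).trans (hφ (fun X => X.elim) fun _ => t)⟩
  refine ⟨T, ZFSet.sep_subset, ⟨?_, fun c d => ?_, fun c => ?_, ?_, fun c => ?_, fun c d => ?_,
    fun c d => ?_⟩, ?_⟩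
  · obtain ⟨c, hc⟩ := hex (fun _ => False) .false
    exact ⟨c, fun t => (hc t).1⟩
  · exact hex _ (.imp (hsec c) (hsec d))
  · exact hex _ (.all (hterm c (.pair (.var _) (.var _))))
  · obtain ⟨c, hc⟩ := hex (fun s => ∃ t y x, s = vpair hlim (vpair hlim t y) x ∧ y = x)
      (.ex (.ex (.ex (.and (.eq (.var _) (.pair (.pair (.var _) (.var _)) (.var _)))
        (.eq_var _ _)))))
    refine ⟨c, fun t y x => (hc _).trans ?_⟩
    simp only [vpair_inj]
    aesop
  · obtain ⟨d, hd⟩ := hex (fun s => ∃ t y x, s = vpair hlim (vpair hlim t y) x ∧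
        (vpair hlim c (vpair hlim t x) : ZFSet) ∈ T)
      (.ex (.ex (.ex (.and (.eq (.var _) (.pair (.pair (.var _) (.var _)) (.var _)))
        (hterm c (.pair (.var _) (.var _)))))))
    refine ⟨d, fun t y x => (hd _).trans ?_⟩
    simp only [vpair_inj]
    aesop
  · exact hex _ (.ex (.ex (.and (hterm c (.pair (.var _) (.var _)))
      (.and (hterm d (.pair (.var _) (.var _))) (.eq_var _ _)))))
  · exact hex _ (.ex (.ex (.and (hterm c (.pair (.var _) (.var _)))
      (.and (hterm d (.pair (.var _) (.var _))) (.mem_var _ _)))))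
  · intro c t t' h
    obtain rfl := (vpair_mem_graph j hlim).1 h
    exact (hsec c).map_iff j fun _ => t

/-! ### Reflecting the existence of a square root -/

/-- Square roots from `Σ¹₁`-elementarity, with parameters indexed by arbitrary finite types. -/
theorem exists_squareRoot {ι κ : Type} [Finite ι] [Finite κ] (hlim : Order.IsSuccLimit lam)
    {j : ElemEmb lam} (hj : j ∈ E lam) (hjS : IsSigmaOneOne j) (a : ι → ZFSet.{u})
    (b : κ → ZFSet.{u}) (ha : ∀ i, a i ∈ V_ (lam + 1)) (hb : ∀ l, b l ∈ V_ (lam + 1)) :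
    ∃ k ∈ E lam, IsSquareRoot k j ∧ (∀ i, a i ∈ extRange k) ∧ ∀ l, app k (b l) = app j (b l) := by
  have hV {x : ZFSet.{u}} : x ∈ V_ (lam + 1) ↔ x ⊆ V_ lam := by
    rw [ZFSet.vonNeumann_add_one, ZFSet.mem_powerset]
  obtain ⟨p, ⟨eA⟩⟩ := Finite.exists_equiv_fin (Unit ⊕ ι ⊕ κ ⊕ κ)
  obtain ⟨q, ⟨eX⟩⟩ := Finite.exists_equiv_fin (Bool ⊕ ι)
  let K : Fin p ⊕ Fin q := .inr (eX (.inl true))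
  let T : Fin p ⊕ Fin q := .inr (eX (.inl false))
  obtain ⟨ψ, hψ⟩ : Expressible lam (Fin p ⊕ Fin q) (n := 0) fun S _ =>
      (IsPairingMap hlim (S K) ∧ IsClosedFamily hlim (S T) ∧ PreservesFamily hlim (S K) (S T)) ∧
      AppEq hlim (S K) (S K) (S (.inl (eA (.inl ())))) ∧
      (∀ i, AppEq hlim (S K) (S (.inr (eX (.inr i)))) (S (.inl (eA (.inr (.inl i)))))) ∧
      ∀ l, AppEq hlim (S K) (S (.inl (eA (.inr (.inr (.inl l))))))
        (S (.inl (eA (.inr (.inr (.inr l)))))) :=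
    .and (.and (expressible_isPairingMap hlim K) (.and (expressible_isClosedFamily hlim T)
      (expressible_preservesFamily hlim K T))) (.and (expressible_appEq hlim _ _ _)
      (.and (.finite_forall fun i => expressible_appEq hlim _ _ _)
        (.finite_forall fun l => expressible_appEq hlim _ _ _)))
  let A : Fin p → ZFSet.{u} := fun i => Sum.elim (fun _ => graph j)
    (Sum.elim a (Sum.elim b fun l => app j (b l))) (eA.symm i)
  have hA (i) : A i ∈ V_ (lam + 1) := by
    dsimp only [A]
    rcases eA.symm i with _ | i | l | l
    · exact hV.2 (graph_subset j hlim)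
    · exact ha i
    · exact hb l
    · exact hV.2 (app_subset j _)
  -- The statement is verified at the parameters moved by `j`, with witnesses `graph j`, `T'` and
  -- `a`, and pulled back to the original ones.
  obtain ⟨X, hX, hXψ⟩ := (hjS p q 0 ψ A Fin.elim0 hA).2 <| by
    obtain ⟨T', hT'V, hT', hjT'⟩ := exists_closedFamily hlim j
    refine ⟨fun i => Sum.elim (fun c => if c then graph j else T') a (eX.symm i), fun i => ?_,
      (hψ _ _).2 ?_⟩
    · dsimp only
      rcases eX.symm i with (_ | _) | i
      · exact hT'V
      · exact graph_subset j hlim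
      · exact hV.1 (ha i)
    · simp only [K, T, A, Sum.elim_inl, Sum.elim_inr, Equiv.symm_apply_apply, if_true,
        Bool.false_eq_true, if_false]
      refine ⟨⟨isPairingMap_graph j hlim, hT', hjT'⟩, ?_, fun i => ?_, fun l => ?_⟩ <;>
        exact (appEq_graph_iff j hlim (app_subset j _)).2 rfl
  obtain ⟨⟨hK, hT, hKT⟩, hroot, hrange, hagree⟩ := (hψ _ _).1 hXψ
  simp only [K, T, A, Sum.elim_inl, Sum.elim_inr, Equiv.symm_apply_apply] at *
  obtain ⟨k, hk⟩ := exists_elemEmb (hX _) hK hT hKT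
  rw [← hk] at hroot
  simp only [← hk] at hrange hagree
  have hkj : IsSquareRoot k j := (appEq_graph_iff k hlim (graph_subset j hlim)).1 hroot
  refine ⟨k, ?_, hkj, fun i => ⟨ha i, _, hV.2 (hX _),
    (appEq_graph_iff k hlim (hV.1 (ha i))).1 (hrange i)⟩,
    fun l => (appEq_graph_iff k hlim (app_subset j _)).1 (hagree l)⟩
  -- If `k` were the identity, every element of k·k would lie in the graph of `k`; as k·k = j, also
  -- `j` would be the identity.
  by_contra hid
  have hid' (x) : k x = x := by
    by_contra h
    exact hid ⟨x, h⟩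
  obtain ⟨x, hx⟩ := hj
  have hmem : (vpair hlim x (j x) : ZFSet) ∈ app k (graph k) := by
    rw [hkj]
    exact (vpair_mem_graph j hlim).2 rfl
  obtain ⟨w, hw, hxw⟩ := (mem_app k).1 hmem
  rw [hid'] at hxw
  exact hx (((vpair_mem_graph k hlim).1 (hw hxw)).symm.trans (hid' x))

end RankEmb

theorem lemma16 (lam : Ordinal.{u}) (hlim : Order.IsSuccLimit lam) (hcof : lam.cof = ℵ₀)
    (j : RankEmb.ElemEmb lam) (hj : j ∈ RankEmb.E lam) (hjS : RankEmb.IsSigmaOneOne j)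
    (m n : ℕ) (a : Fin (m + 1) → ZFSet.{u}) (b : Fin (n + 1) → ZFSet.{u})
    (ha : ∀ i, a i ∈ V_ (lam + 1)) (hb : ∀ l, b l ∈ V_ (lam + 1)) :
    ∃ k ∈ RankEmb.E lam, RankEmb.IsSquareRoot k j ∧
      (∀ i, a i ∈ RankEmb.extRange k) ∧
      ∀ l, RankEmb.app k (b l) = RankEmb.app j (b l) := by
  exact RankEmb.exists_squareRoot hlim hj hjS a b ha hb
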